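/- Let $d\ge 1$, $\nu>0$ and $p>1$ be fixed, and write $F(u)=\nu\Delta u-\tfrac1p\,\partial_{x_1}\bigl(|u|^p\bigr)$ for real-valued functions $u$ on $\mathbb{R}^d$. For $u\in C^2(\mathbb{R}^d)$ the derivatives are classical and $F(u)\in C^0(\mathbb{R}^d)$; for $u\in H^2(\mathbb{R}^d)\cap L^\infty(\mathbb{R}^d)$ they are weak derivatives and $F(u)\in L^2(\mathbb{R}^d)$; in both cases $F(u)$ is well defined. Let $\alpha>0$, $b\in\mathbb{R}^d$, $M\in\mathbb{R}^{d\times d}$ invertible and $c\in\mathbb{R}$. For $v:\mathbb{R}^d\to\mathbb{R}$ put $$u(x)=\frac1\alpha\,v\bigl(M^{-1}(x-b)\bigr),\qquad x\in\mathbb{R}^d .$$ Then $u\in C^2(\mathbb{R}^d)$ if and only if $v\in C^2(\mathbb{R}^d)$, and $u\in H^2(\mathbb{R}^d)\cap L^\infty(\mathbb{R}^d)$ if and only if $v\in H^2(\mathbb{R}^d)\cap L^\infty(\mathbb{R}^d)$. Moreover, the identity $$F(u)=c\,\frac1\alpha\,F(v)\bigl(M^{-1}(\cdot-b)\bigr)$$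 holds in $C^0(\mathbb{R}^d)$ for all $v\in C^2(\mathbb{R}^d)$ if and only if $$M=\alpha^{p-1}\begin{pmatrix}1&0\\0&Q\end{pmatrix}\ \text{ for some orthogonal } Q\in\mathcal{O}(d-1),\qquad\text{and}\qquad c=\alpha^{2-2p}.$$ Likewise, the identity holds in $L^2(\mathbb{R}^d)$ for all $v\in H^2(\mathbb{R}^d)\cap L^\infty(\mathbb{R}^d)$ if and only if the same condition on $M$ and $c$ is satisfied. (For $d=1$ the condition on $M$ reads $M=\alpha^{p-1}$.) -/

import Mathlib

open MeasureTheory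
open scoped ContDiff ENNReal

noncomputable section

namespace Burgers

/-- `ℝᵈ` with `d = n + 1 ≥ 1` and the Euclidean norm; the coordinate `x₁` has the index `0`. -/
abbrev E (n : ℕ) : Type := EuclideanSpace ℝ (Fin (n + 1))

/-- The `i`-th standard unit vector of `ℝᵈ`. -/
def unitVec {n : ℕ} (i : Fin (n + 1)) : E n := EuclideanSpace.single i 1

/-- The block matrix `diag(1, Q)`, of size `d = n + 1`, for `Q` of size `d - 1 = n`. -/
def blockOne {n : ℕ} (Q : Matrix (Fin n) (Fin n) ℝ) :
    Matrix (Fin (n + 1)) (Fin (n + 1)) ℝ :=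
  Matrix.of (Fin.cons (Fin.cons 1 fun _ => 0) fun i => Fin.cons 0 (Q i))

/-- The change of variables `x ↦ M⁻¹ (x - b)` of `ℝᵈ`. -/
def backward {n : ℕ} (M : Matrix (Fin (n + 1)) (Fin (n + 1)) ℝ) (b x : E n) : E n :=
  Matrix.toEuclideanLin M⁻¹ (x - b)

/-- The function `x ↦ α⁻¹ v (M⁻¹ (x - b))`. -/
def transform {n : ℕ} (α : ℝ) (M : Matrix (Fin (n + 1)) (Fin (n + 1)) ℝ) (b : E n)
    (v : E n → ℝ) : E n → ℝ :=
  fun x => α⁻¹ * v (backward M b x)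

/-- The classical operator `F(u) = ν Δu - (1/p) ∂_{x₁} |u|ᵖ`, for `u` of class `C²`. -/
def burgersOp {n : ℕ} (ν p : ℝ) (u : E n → ℝ) : E n → ℝ :=
  fun x => ν * Laplacian.laplacian u x
    - 1 / p * fderiv ℝ (fun y => |u y| ^ p) x (unitVec 0)

/-- `g` is a weak partial derivative `∂ᵢ u` on `ℝᵈ`: both are locally integrable and
`∫ u ∂ᵢφ = -∫ g φ` for all test functions `φ ∈ C_c^∞(ℝᵈ)`. -/
def HasWeakPartial {n : ℕ} (i : Fin (n + 1)) (u g : E n → ℝ) : Prop :=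
  LocallyIntegrable u ∧ LocallyIntegrable g ∧
    ∀ φ : E n → ℝ, ContDiff ℝ ∞ φ → HasCompactSupport φ →
      ∫ x, u x * fderiv ℝ φ x (unitVec i) = -∫ x, g x * φ x

/-- `u ∈ H²(ℝᵈ)`: `u` and all its weak partial derivatives of order one and two are in `L²`. -/
def MemH2 {n : ℕ} (u : E n → ℝ) : Prop :=
  MemLp u 2 ∧ ∃ (g : Fin (n + 1) → E n → ℝ) (h : Fin (n + 1) → Fin (n + 1) → E n → ℝ),
    (∀ i, MemLp (g i) 2 ∧ HasWeakPartial i u (g i)) ∧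
      ∀ i j, MemLp (h i j) 2 ∧ HasWeakPartial j (g i) (h i j)

/-- `u ∈ H²(ℝᵈ) ∩ L^∞(ℝᵈ)`. -/
def MemH2Linf {n : ℕ} (u : E n → ℝ) : Prop :=
  MemH2 u ∧ MemLp u ∞

/-- `F(u) = f` in `L²(ℝᵈ)`, where in `F(u) = ν Δu - (1/p) ∂_{x₁} |u|ᵖ` all derivatives are weak
derivatives: `g i` is `∂ᵢ u`, `h i` is `∂ᵢ ∂ᵢ u` and `w` is `∂_{x₁} |u|ᵖ`. -/
def IsBurgersL2 {n : ℕ} (ν p : ℝ) (u : E n → ℝ) (f : Lp ℝ 2 (volume : Measure (E n))) : Prop :=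
  ∃ (g h : Fin (n + 1) → E n → ℝ) (w : E n → ℝ),
    (∀ i, HasWeakPartial i u (g i)) ∧
    (∀ i, HasWeakPartial i (g i) (h i)) ∧
    HasWeakPartial 0 (fun x => |u x| ^ p) w ∧
    f =ᵐ[volume] fun x => ν * ∑ i, h i x - 1 / p * w x

end Burgers

end

/-! Put N = M⁻¹. The chain rule gives Δu = α⁻¹ ∑ (N Nᵀ)ₖₗ ∂ₖ∂ₗv and ∂₁|u|ᵖ = α⁻ᵖ ∑ Nₖ₁ ∂ₖ|v|ᵖ, with
the right-hand sides taken at N(x - b). Hence the identity holds as soon as N Nᵀ = c·1 and N e₁ = c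
α^(p-1) e₁. Linear algebra (`inv_mul_transpose_iff`) turns these two equations into the stated form
of M and c.

For necessity, the identity is evaluated at x = b, where N(x - b) = 0, for v = zₖzₗ and v = 1 + zₖ
near 0. The first choice isolates the diffusion term and yields N Nᵀ, the second isolates the
convection term and yields N e₁ (`condition_of_burgersOp_transform_eq`). Since F is local, these
polynomials may be cut off. So only compactly supported C² functions are needed; they lie in both
function classes, and the L² statement reduces to the classical one by continuity.

The weak setting needs two further facts: weak derivatives obey the affine change of variables
(`HasWeakDir.comp_backward`), and |u|ᵖ obeys the chain rule for bounded u
(`HasWeakDir.comp_contDiff`, by mollification), which makes F(u) ∈ L² well defined. Arbitrary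
directions are used because the change of variables sends eᵢ to the i-th column of N. -/

noncomputable section

namespace Burgers

/-! ### Weak directional derivatives -/

variable {n : ℕ}

/-- `g` is a weak derivative of `u` in the direction `a`. -/
def HasWeakDir (a : E n) (u g : E n → ℝ) : Prop :=
  LocallyIntegrable u ∧ LocallyIntegrable g ∧
    ∀ φ : E n → ℝ, ContDiff ℝ ∞ φ → HasCompactSupport φ →
      ∫ x, u x * fderiv ℝ φ x a = -∫ x, g x * φ x

lemma hasWeakPartial_iff {i : Fin (n + 1)} {u g : E n → ℝ} :
    HasWeakPartial i u g ↔ HasWeakDir (unitVec i) u g := Iff.rfl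

lemma continuous_fderiv_apply_const {φ : E n → ℝ} (hφ : ContDiff ℝ 1 φ) (a : E n) :
    Continuous fun x => fderiv ℝ φ x a :=
  (hφ.continuous_fderiv one_ne_zero).clm_apply continuous_const

lemma integrable_mul_test {u φ : E n → ℝ} (hu : LocallyIntegrable u) (hφ : Continuous φ)
    (hc : HasCompactSupport φ) : Integrable fun x => u x * φ x := by
  simpa [mul_comm] using hu.integrable_smul_left_of_hasCompactSupport hφ hc

lemma integrable_mul_fderiv_test {u φ : E n → ℝ} (hu : LocallyIntegrable u)
    (hφ : ContDiff ℝ 1 φ) (hc : HasCompactSupport φ) (a : E n) :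
    Integrable fun x => u x * fderiv ℝ φ x a :=
  integrable_mul_test hu (continuous_fderiv_apply_const hφ a) (hc.fderiv_apply (𝕜 := ℝ) a)

lemma HasWeakDir.unique {a : E n} {u g g' : E n → ℝ} (h : HasWeakDir a u g)
    (h' : HasWeakDir a u g') : g =ᵐ[volume] g' := by
  have key := ae_eq_zero_of_integral_contDiff_smul_eq_zero (μ := (volume : Measure (E n)))
    (h.2.1.sub h'.2.1) (fun φ hφ hc => by
      have e1 := h.2.2 φ hφ hc
      have e2 := h'.2.2 φ hφ hc
      have i1 := integrable_mul_test h.2.1 hφ.continuous hc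
      have i2 := integrable_mul_test h'.2.1 hφ.continuous hc
      have : (fun x => φ x • (g - g') x) = fun x => g x * φ x - g' x * φ x := by
        ext x; simp only [Pi.sub_apply, smul_eq_mul]; ring
      rw [this, integral_sub i1 i2]
      linarith)
  filter_upwards [key] with x hx
  simpa [sub_eq_zero] using hx

lemma locallyIntegrable_congr_ae {u u' : E n → ℝ} (hu : LocallyIntegrable u)
    (h : u =ᵐ[volume] u') : LocallyIntegrable u' := fun x => by
  obtain ⟨s, hs, hi⟩ := hu x
  exact ⟨s, hs, hi.congr (ae_restrict_of_ae h)⟩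

lemma HasWeakDir.congr_ae {a : E n} {u u' g g' : E n → ℝ} (h : HasWeakDir a u g)
    (hu : u =ᵐ[volume] u') (hg : g =ᵐ[volume] g') : HasWeakDir a u' g' := by
  refine ⟨locallyIntegrable_congr_ae h.1 hu, locallyIntegrable_congr_ae h.2.1 hg, ?_⟩
  intro φ hφ hc
  have e1 : ∫ x, u' x * fderiv ℝ φ x a = ∫ x, u x * fderiv ℝ φ x a :=
    integral_congr_ae (by filter_upwards [hu] with x hx; rw [hx])
  have e2 : ∫ x, g' x * φ x = ∫ x, g x * φ x :=
    integral_congr_ae (by filter_upwards [hg] with x hx; rw [hx])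
  rw [e1, e2, h.2.2 φ hφ hc]

lemma HasWeakDir.smul_dir {a : E n} {u g : E n → ℝ} (h : HasWeakDir a u g) (t : ℝ) :
    HasWeakDir (t • a) u (fun x => t * g x) := by
  refine ⟨h.1, h.2.1.smul t, fun φ hφ hc => ?_⟩
  have := h.2.2 φ hφ hc
  simp only [map_smul, smul_eq_mul, mul_left_comm _ t, mul_assoc, integral_const_mul, this]
  ring

lemma HasWeakDir.const_mul {a : E n} {u g : E n → ℝ} (h : HasWeakDir a u g) (t : ℝ) :
    HasWeakDir a (fun x => t * u x) (fun x => t * g x) := by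
  refine ⟨h.1.smul t, h.2.1.smul t, fun φ hφ hc => ?_⟩
  have := h.2.2 φ hφ hc
  simp only [mul_assoc, integral_const_mul, this]
  ring

lemma HasWeakDir.sum_dir {ι : Type*} (s : Finset ι) {a : ι → E n} {u : E n → ℝ}
    {g : ι → E n → ℝ} (hu : LocallyIntegrable u) (h : ∀ k ∈ s, HasWeakDir (a k) u (g k)) :
    HasWeakDir (∑ k ∈ s, a k) u (fun x => ∑ k ∈ s, g k x) := by
  refine ⟨hu, locallyIntegrable_finsetSum s fun k hk => (h k hk).2.1, fun φ hφ hc => ?_⟩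
  have hφ1 : ContDiff ℝ 1 φ := hφ.of_le (by exact_mod_cast le_top)
  simp only [map_sum, Finset.mul_sum, Finset.sum_mul]
  rw [integral_finsetSum s fun k hk => integrable_mul_fderiv_test hu hφ1 hc (a k),
    integral_finsetSum s fun k hk => integrable_mul_test (h k hk).2.1 hφ.continuous hc,
    ← Finset.sum_neg_distrib]
  exact Finset.sum_congr rfl fun k hk => (h k hk).2.2 φ hφ hc

lemma HasWeakDir.sum {ι : Type*} (s : Finset ι) {a : E n} {u g : ι → E n → ℝ}
    (h : ∀ k ∈ s, HasWeakDir a (u k) (g k)) :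
    HasWeakDir a (fun x => ∑ k ∈ s, u k x) (fun x => ∑ k ∈ s, g k x) := by
  refine ⟨locallyIntegrable_finsetSum s fun k hk => (h k hk).1,
    locallyIntegrable_finsetSum s fun k hk => (h k hk).2.1, fun φ hφ hc => ?_⟩
  have hφ1 : ContDiff ℝ 1 φ := hφ.of_le (by exact_mod_cast le_top)
  simp only [Finset.sum_mul]
  rw [integral_finsetSum s fun k hk => integrable_mul_fderiv_test (h k hk).1 hφ1 hc a,
    integral_finsetSum s fun k hk => integrable_mul_test (h k hk).2.1 hφ.continuous hc,
    ← Finset.sum_neg_distrib]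
  exact Finset.sum_congr rfl fun k hk => (h k hk).2.2 φ hφ hc

/-- Integration by parts against a compactly supported `C¹` function. -/
lemma integral_mul_fderiv_of_contDiff {u φ : E n → ℝ} (hu : ContDiff ℝ 1 u)
    (hφ : ContDiff ℝ 1 φ) (hc : HasCompactSupport φ) (a : E n) :
    ∫ x, u x * fderiv ℝ φ x a = -∫ x, fderiv ℝ u x a * φ x :=
  integral_mul_fderiv_eq_neg_fderiv_mul_of_integrable
    (integrable_mul_test (continuous_fderiv_apply_const hu a).locallyIntegrable hφ.continuous hc)
    (integrable_mul_fderiv_test hu.continuous.locallyIntegrable hφ hc a)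
    (integrable_mul_test hu.continuous.locallyIntegrable hφ.continuous hc)
    (fun x _ => hu.differentiable one_ne_zero x) (fun x _ => hφ.differentiable one_ne_zero x)

lemma hasWeakDir_of_contDiff {u : E n → ℝ} (hu : ContDiff ℝ 1 u) (a : E n) :
    HasWeakDir a u (fun x => fderiv ℝ u x a) :=
  ⟨hu.continuous.locallyIntegrable, (continuous_fderiv_apply_const hu a).locallyIntegrable,
    fun _ hφ hc =>
      integral_mul_fderiv_of_contDiff hu (hφ.of_le (by exact_mod_cast le_top)) hc a⟩

/-! ### The affine change of variables, and invariance of the function classes -/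

lemma toEuclideanLin_mul_apply (A B : Matrix (Fin (n + 1)) (Fin (n + 1)) ℝ) (x : E n) :
    Matrix.toEuclideanLin (A * B) x = Matrix.toEuclideanLin A (Matrix.toEuclideanLin B x) := by
  simp [Matrix.toLpLin_apply, Matrix.mulVec_mulVec]

lemma toEuclideanLin_one_apply (x : E n) :
    Matrix.toEuclideanLin (1 : Matrix (Fin (n + 1)) (Fin (n + 1)) ℝ) x = x := by
  simp

lemma toEuclideanLin_inv_apply_apply {M : Matrix (Fin (n + 1)) (Fin (n + 1)) ℝ} (hM : IsUnit M)
    (x : E n) : Matrix.toEuclideanLin M⁻¹ (Matrix.toEuclideanLin M x) = x := by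
  rw [← toEuclideanLin_mul_apply, Matrix.nonsing_inv_mul _ ((Matrix.isUnit_iff_isUnit_det M).1 hM),
    toEuclideanLin_one_apply]

lemma toEuclideanLin_apply_inv_apply {M : Matrix (Fin (n + 1)) (Fin (n + 1)) ℝ} (hM : IsUnit M)
    (x : E n) : Matrix.toEuclideanLin M (Matrix.toEuclideanLin M⁻¹ x) = x := by
  rw [← toEuclideanLin_mul_apply, Matrix.mul_nonsing_inv _ ((Matrix.isUnit_iff_isUnit_det M).1 hM),
    toEuclideanLin_one_apply]

lemma contDiff_toEuclideanLin (M : Matrix (Fin (n + 1)) (Fin (n + 1)) ℝ) {k : WithTop ℕ∞} :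
    ContDiff ℝ k (Matrix.toEuclideanLin M : E n → E n) :=
  (LinearMap.toContinuousLinearMap (Matrix.toEuclideanLin M)).contDiff

lemma contDiff_backward (M : Matrix (Fin (n + 1)) (Fin (n + 1)) ℝ) (b : E n) {k : WithTop ℕ∞} :
    ContDiff ℝ k (backward M b) :=
  (contDiff_toEuclideanLin M⁻¹).comp (contDiff_id.sub contDiff_const)

lemma hasFDerivAt_backward (M : Matrix (Fin (n + 1)) (Fin (n + 1)) ℝ) (b x : E n) :
    HasFDerivAt (backward M b) (LinearMap.toContinuousLinearMap (Matrix.toEuclideanLin M⁻¹)) x :=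
  HasFDerivAt.comp (f := fun y => y - b) x
    (LinearMap.toContinuousLinearMap (Matrix.toEuclideanLin M⁻¹)).hasFDerivAt
    ((hasFDerivAt_id x).sub_const b)

lemma fderiv_comp_backward (M : Matrix (Fin (n + 1)) (Fin (n + 1)) ℝ) (b x a : E n) {v : E n → ℝ}
    (hv : DifferentiableAt ℝ v (backward M b x)) :
    fderiv ℝ (fun y => v (backward M b y)) x a =
      fderiv ℝ v (backward M b x) (Matrix.toEuclideanLin M⁻¹ a) := by
  have h := (hv.hasFDerivAt.comp x (hasFDerivAt_backward M b x)).fderiv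
  have h' : fderiv ℝ (fun y => v (backward M b y)) x = _ := h
  rw [h']; rfl

/-- The change of variables `x ↦ M⁻¹ (x - b)` as a homeomorphism. -/
def backwardHomeo {M : Matrix (Fin (n + 1)) (Fin (n + 1)) ℝ} (hM : IsUnit M) (b : E n) :
    E n ≃ₜ E n where
  toFun := backward M b
  invFun y := Matrix.toEuclideanLin M y + b
  left_inv x := by simp [backward, toEuclideanLin_apply_inv_apply hM]
  right_inv y := by simp [backward, toEuclideanLin_inv_apply_apply hM]
  continuous_toFun := (contDiff_backward M b (k := 0)).continuous
  continuous_invFun := ((contDiff_toEuclideanLin M (k := 0)).continuous).add continuous_const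

@[simp] lemma backwardHomeo_apply {M : Matrix (Fin (n + 1)) (Fin (n + 1)) ℝ} (hM : IsUnit M)
    (b x : E n) : backwardHomeo hM b x = backward M b x := rfl

/-- The factor is |det M|. Its value is never needed: it enters both sides of the integration by
parts formula in the same way. -/
lemma exists_map_backward_eq {M : Matrix (Fin (n + 1)) (Fin (n + 1)) ℝ} (hM : IsUnit M)
    (b : E n) : ∃ k : ℝ≥0∞, k ≠ 0 ∧ k ≠ ⊤ ∧
      Measure.map (backwardHomeo hM b) volume = k • (volume : Measure (E n)) := by
  have hdet : LinearMap.det (Matrix.toEuclideanLin M⁻¹ : E n →ₗ[ℝ] E n) ≠ 0 := by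
    intro h0
    have h1 : (Matrix.toEuclideanLin M⁻¹ : E n →ₗ[ℝ] E n) ∘ₗ Matrix.toEuclideanLin M
        = LinearMap.id := by
      ext1 x; exact toEuclideanLin_inv_apply_apply hM x
    have h2 := congrArg LinearMap.det h1
    rw [LinearMap.det_comp, h0, zero_mul, LinearMap.det_id] at h2
    exact zero_ne_one h2
  refine ⟨ENNReal.ofReal |(LinearMap.det (Matrix.toEuclideanLin M⁻¹ : E n →ₗ[ℝ] E n))⁻¹|,
    ?_, ENNReal.ofReal_ne_top, ?_⟩
  · simpa using hdet
  · rw [← Measure.map_linearMap_addHaar_eq_smul_addHaar (volume : Measure (E n)) hdet]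
    have h1 : Measure.map (fun x : E n => x - b) volume = volume :=
      (measurePreserving_sub_right volume b).map_eq
    conv_rhs => rw [← h1]
    rw [Measure.map_map (contDiff_toEuclideanLin M⁻¹ (k := 0)).continuous.measurable
      (measurable_sub_const b)]
    rfl

lemma exists_integral_comp_backward {M : Matrix (Fin (n + 1)) (Fin (n + 1)) ℝ} (hM : IsUnit M)
    (b : E n) :
    ∃ k : ℝ, ∀ F : E n → ℝ, ∫ x, F (backward M b x) = k * ∫ x, F x := by
  obtain ⟨k, hk0, hk, h⟩ := exists_map_backward_eq hM b
  refine ⟨k.toReal, fun F => ?_⟩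
  have := (backwardHomeo hM b).toMeasurableEquiv.measurableEmbedding.integral_map (μ := volume) F
  simp only [Homeomorph.toMeasurableEquiv_coe, h, backwardHomeo_apply,
    integral_smul_measure, smul_eq_mul] at this
  exact this.symm

lemma quasiMeasurePreserving_backward {M : Matrix (Fin (n + 1)) (Fin (n + 1)) ℝ} (hM : IsUnit M)
    (b : E n) :
    Measure.QuasiMeasurePreserving (backward M b) (volume : Measure (E n)) volume := by
  obtain ⟨k, hk0, hk, h⟩ := exists_map_backward_eq hM b
  refine ⟨(contDiff_backward M b (k := 0)).continuous.measurable, ?_⟩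
  have : Measure.map (backward M b) volume = k • (volume : Measure (E n)) := h
  rw [this]
  exact Measure.smul_absolutelyContinuous

lemma memLp_comp_backward {M : Matrix (Fin (n + 1)) (Fin (n + 1)) ℝ} (hM : IsUnit M)
    (b : E n) {v : E n → ℝ} {q : ℝ≥0∞} (hv : MemLp v q) :
    MemLp (fun x => v (backward M b x)) q := by
  obtain ⟨k, hk0, hk, h⟩ := exists_map_backward_eq hM b
  have h1 : MemLp v q (Measure.map (backwardHomeo hM b) volume) := by
    rw [h]; exact hv.smul_measure hk
  exact h1.comp_of_map (backwardHomeo hM b).continuous.aemeasurable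

lemma locallyIntegrable_comp_backward {M : Matrix (Fin (n + 1)) (Fin (n + 1)) ℝ} (hM : IsUnit M)
    (b : E n) {v : E n → ℝ} (hv : LocallyIntegrable v) :
    LocallyIntegrable fun x => v (backward M b x) := by
  obtain ⟨k, hk0, hk, h⟩ := exists_map_backward_eq hM b
  have h1 : LocallyIntegrable v (Measure.map (backwardHomeo hM b) volume) := by
    rw [h]; exact fun x => let ⟨s, hs, hi⟩ := hv x; ⟨s, hs, by
      rw [IntegrableOn, Measure.restrict_smul]; exact hi.smul_measure hk⟩
  exact (locallyIntegrable_map_homeomorph _).1 h1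

/-- The test function is transported by the inverse map. The classical chain rule on the test
function turns `a` into M⁻¹a, and both integrals pick up the same Jacobian factor. -/
lemma HasWeakDir.comp_backward {M : Matrix (Fin (n + 1)) (Fin (n + 1)) ℝ} (hM : IsUnit M)
    (b : E n) {a : E n} {v g : E n → ℝ}
    (h : HasWeakDir (Matrix.toEuclideanLin M⁻¹ a) v g) :
    HasWeakDir a (fun x => v (backward M b x)) (fun x => g (backward M b x)) := by
  refine ⟨locallyIntegrable_comp_backward hM b h.1, locallyIntegrable_comp_backward hM b h.2.1, ?_⟩
  intro φ hφ hc
  set ψ : E n → ℝ := fun y => φ ((backwardHomeo hM b).symm y) with hψ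
  have hψs : ContDiff ℝ ∞ ψ := hφ.comp ((contDiff_toEuclideanLin M).add contDiff_const)
  have hψc : HasCompactSupport ψ := hc.comp_homeomorph (backwardHomeo hM b).symm
  have hφψ : φ = fun x => ψ (backward M b x) := by
    ext x
    exact congrArg φ ((backwardHomeo hM b).symm_apply_apply x).symm
  have hd : ∀ x, fderiv ℝ φ x a = fderiv ℝ ψ (backward M b x) (Matrix.toEuclideanLin M⁻¹ a) := by
    intro x
    rw [hφψ]
    exact fderiv_comp_backward M b x a (hψs.differentiable (by simp) _)
  obtain ⟨k, hk⟩ := exists_integral_comp_backward hM b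
  have e1 := hk fun y => v y * fderiv ℝ ψ y (Matrix.toEuclideanLin M⁻¹ a)
  have e2 := hk fun y => g y * ψ y
  simp only [hd]
  rw [e1, h.2.2 ψ hψs hψc]
  rw [hφψ]
  simp only
  rw [e2]; ring

lemma toEuclideanLin_unitVec (A : Matrix (Fin (n + 1)) (Fin (n + 1)) ℝ) (i : Fin (n + 1)) :
    Matrix.toEuclideanLin A (unitVec i) = ∑ k, A k i • unitVec k := by
  ext j
  simp [unitVec, Matrix.toLpLin_apply, Finset.sum_apply]
  simp [Pi.single_apply]

lemma hasWeakPartial_comp_backward {M : Matrix (Fin (n + 1)) (Fin (n + 1)) ℝ} (hM : IsUnit M)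
    (b : E n) {v : E n → ℝ} {g : Fin (n + 1) → E n → ℝ} (h : ∀ k, HasWeakPartial k v (g k))
    (i : Fin (n + 1)) :
    HasWeakPartial i (fun x => v (backward M b x))
      (fun x => ∑ k, M⁻¹ k i * g k (backward M b x)) := by
  rw [hasWeakPartial_iff]
  refine HasWeakDir.comp_backward hM b (g := fun y => ∑ k, M⁻¹ k i * g k y) ?_
  rw [toEuclideanLin_unitVec]
  exact HasWeakDir.sum_dir Finset.univ (h 0).1 fun k _ => HasWeakDir.smul_dir (h k) _

/-- The weak derivatives of first and second order of `transform α M b v`. -/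
lemma hasWeakPartial_transform {M : Matrix (Fin (n + 1)) (Fin (n + 1)) ℝ} (hM : IsUnit M)
    (b : E n) (α : ℝ) {v : E n → ℝ} {g : Fin (n + 1) → E n → ℝ}
    (h : ∀ k, HasWeakPartial k v (g k)) (i : Fin (n + 1)) :
    HasWeakPartial i (transform α M b v)
      (fun x => α⁻¹ * ∑ k, M⁻¹ k i * g k (backward M b x)) :=
  HasWeakDir.const_mul (hasWeakPartial_comp_backward hM b h i) α⁻¹

lemma hasWeakPartial_transform_second {M : Matrix (Fin (n + 1)) (Fin (n + 1)) ℝ} (hM : IsUnit M)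
    (b : E n) (α : ℝ) {g : Fin (n + 1) → E n → ℝ} {h : Fin (n + 1) → Fin (n + 1) → E n → ℝ}
    (hh : ∀ k l, HasWeakPartial l (g k) (h k l)) (i j : Fin (n + 1)) :
    HasWeakPartial j (fun x => α⁻¹ * ∑ k, M⁻¹ k i * g k (backward M b x))
      (fun x => α⁻¹ * ∑ k, M⁻¹ k i * ∑ l, M⁻¹ l j * h k l (backward M b x)) :=
  HasWeakDir.const_mul (HasWeakDir.sum Finset.univ fun k _ =>
    HasWeakDir.const_mul (hasWeakPartial_comp_backward hM b (hh k) j) _) α⁻¹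

lemma MemH2Linf.transform {M : Matrix (Fin (n + 1)) (Fin (n + 1)) ℝ} (hM : IsUnit M)
    (b : E n) (α : ℝ) {v : E n → ℝ} (hv : MemH2Linf v) : MemH2Linf (transform α M b v) := by
  obtain ⟨⟨hv2, g, h, hg, hh⟩, hvi⟩ := hv
  refine ⟨⟨(memLp_comp_backward hM b hv2).const_mul α⁻¹, _, _, fun i => ⟨?_,
    hasWeakPartial_transform hM b α (fun k => (hg k).2) i⟩, fun i j => ⟨?_,
    hasWeakPartial_transform_second hM b α (fun k l => (hh k l).2) i j⟩⟩,
    (memLp_comp_backward hM b hvi).const_mul α⁻¹⟩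
  · exact (memLp_finsetSum _ fun k _ =>
      (memLp_comp_backward hM b (hg k).1).const_mul _).const_mul α⁻¹
  · exact (memLp_finsetSum _ fun k _ => (memLp_finsetSum _ fun l _ =>
      (memLp_comp_backward hM b (hh k l).1).const_mul _).const_mul _).const_mul α⁻¹

/-- The inverse of a transformation is again one, as M(y + M⁻¹b) = My + b. One implication therefore
suffices for each invariance statement. -/
lemma transform_transform_inv {M : Matrix (Fin (n + 1)) (Fin (n + 1)) ℝ} (hM : IsUnit M)
    (b : E n) {α : ℝ} (hα : α ≠ 0) (v : E n → ℝ) :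
    transform α⁻¹ M⁻¹ (-Matrix.toEuclideanLin M⁻¹ b) (transform α M b v) = v := by
  ext y
  have hMM : M⁻¹⁻¹ = M := Matrix.nonsing_inv_nonsing_inv M ((Matrix.isUnit_iff_isUnit_det M).1 hM)
  simp [transform, backward, hMM, toEuclideanLin_inv_apply_apply hM,
    toEuclideanLin_apply_inv_apply hM, hα]

lemma memH2Linf_transform_iff {M : Matrix (Fin (n + 1)) (Fin (n + 1)) ℝ} (hM : IsUnit M)
    (b : E n) {α : ℝ} (hα : α ≠ 0) (v : E n → ℝ) :
    MemH2Linf (transform α M b v) ↔ MemH2Linf v := by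
  refine ⟨fun h => ?_, fun h => h.transform hM b α⟩
  rw [← transform_transform_inv hM b hα v]
  exact h.transform (Matrix.isUnit_nonsing_inv_iff.2 hM) _ _

lemma contDiff_transform {k : WithTop ℕ∞} (M : Matrix (Fin (n + 1)) (Fin (n + 1)) ℝ)
    (b : E n) (α : ℝ) {v : E n → ℝ} (hv : ContDiff ℝ k v) : ContDiff ℝ k (transform α M b v) :=
  contDiff_const.mul (hv.comp (contDiff_backward M b))

lemma contDiff_transform_iff {k : WithTop ℕ∞} {M : Matrix (Fin (n + 1)) (Fin (n + 1)) ℝ}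
    (hM : IsUnit M) (b : E n) {α : ℝ} (hα : α ≠ 0) (v : E n → ℝ) :
    ContDiff ℝ k (transform α M b v) ↔ ContDiff ℝ k v := by
  refine ⟨fun h => ?_, contDiff_transform M b α⟩
  rw [← transform_transform_inv hM b hα v]
  exact contDiff_transform _ _ _ h

/-! ### Mollification: pointwise and L¹ convergence -/

section Mollification

open Filter Topology

/-- The mollification of `u` by the normed bump function `φ`. -/
def mollify (φ : ContDiffBump (0 : E n)) (u : E n → ℝ) : E n → ℝ :=
  convolution (φ.normed volume) u (ContinuousLinearMap.lsmul ℝ ℝ) volume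

lemma mollify_apply (φ : ContDiffBump (0 : E n)) (u : E n → ℝ) (x : E n) :
    mollify φ u x = ∫ t, φ.normed volume t * u (x - t) := rfl

lemma mollify_apply_swap (φ : ContDiffBump (0 : E n)) (u : E n → ℝ) (x : E n) :
    mollify φ u x = ∫ t, φ.normed volume (x - t) * u t :=
  convolution_eq_swap _

lemma integrable_mollify_integrand (φ : ContDiffBump (0 : E n)) {u : E n → ℝ}
    (hu : LocallyIntegrable u) (x : E n) :
    Integrable fun t => φ.normed volume t * u (x - t) :=
  φ.hasCompactSupport_normed.convolutionExists_left (ContinuousLinearMap.lsmul ℝ ℝ)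
    φ.continuous_normed hu x

lemma contDiff_mollify (φ : ContDiffBump (0 : E n)) {u : E n → ℝ} (hu : LocallyIntegrable u) :
    ContDiff ℝ ∞ (mollify φ u) :=
  φ.hasCompactSupport_normed.contDiff_convolution_left _ φ.contDiff_normed hu

lemma mollify_add (φ : ContDiffBump (0 : E n)) {u w : E n → ℝ}
    (hu : LocallyIntegrable u) (hw : LocallyIntegrable w) (x : E n) :
    mollify φ (fun y => u y + w y) x = mollify φ u x + mollify φ w x := by
  simp only [mollify_apply, mul_add]
  exact integral_add (integrable_mollify_integrand φ hu x) (integrable_mollify_integrand φ hw x)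

/-- Averages against a probability density inherit the essential bound, and do so at every point.
This keeps the mollified functions in a fixed compact interval in the chain rule. -/
lemma abs_mollify_le_of_ae (φ : ContDiffBump (0 : E n)) {u : E n → ℝ} {K : ℝ}
    (hK : ∀ᵐ x, |u x| ≤ K) (x : E n) : |mollify φ u x| ≤ K := by
  have h1 : |mollify φ u x| ≤ ∫ t, φ.normed volume (x - t) * K := by
    rw [mollify_apply_swap]
    refine norm_integral_le_of_norm_le (f := fun t => φ.normed volume (x - t) * u t)
      ((φ.integrable_normed.comp_sub_left x).mul_const K) ?_
    filter_upwards [hK] with t ht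
    rw [norm_mul, Real.norm_eq_abs, Real.norm_eq_abs, abs_of_nonneg (φ.nonneg_normed _)]
    exact mul_le_mul_of_nonneg_left ht (φ.nonneg_normed _)
  rwa [integral_mul_const, integral_sub_left_eq_self (fun t => φ.normed volume t) volume x,
    φ.integral_normed, one_mul] at h1

lemma abs_mollify_le (φ : ContDiffBump (0 : E n)) (u : E n → ℝ) (x : E n) :
    |mollify φ u x| ≤ mollify φ (fun y => |u y|) x := by
  rw [mollify_apply, mollify_apply]
  refine (abs_integral_le_integral_abs).trans_eq ?_
  simp only [abs_mul, abs_of_nonneg (φ.nonneg_normed _)]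

lemma integrable_mollify (φ : ContDiffBump (0 : E n)) {u : E n → ℝ} (hu : Integrable u) :
    Integrable (mollify φ u) :=
  φ.integrable_normed.integrable_convolution _ hu

lemma integral_abs_mollify_le (φ : ContDiffBump (0 : E n)) {u : E n → ℝ} (hu : Integrable u) :
    ∫ x, |mollify φ u x| ≤ ∫ x, |u x| := by
  have h1 : ∫ x, mollify φ (fun y => |u y|) x = ∫ x, |u x| := by
    have := integral_convolution (ContinuousLinearMap.lsmul ℝ ℝ) (μ := volume)
      (φ.integrable_normed (μ := (volume : Measure (E n)))) hu.abs
    rw [φ.integral_normed] at this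
    simpa [mollify] using this
  rw [← h1]
  exact integral_mono (integrable_mollify φ hu).abs (integrable_mollify φ hu.abs)
    (abs_mollify_le φ u)

lemma mollify_congr_of_ball (φ : ContDiffBump (0 : E n)) {u w : E n → ℝ} {x : E n}
    (h : ∀ y, dist x y ≤ φ.rOut → u y = w y) : mollify φ u x = mollify φ w x := by
  simp only [mollify_apply]
  congr 1
  ext t
  by_cases ht : t ∈ Metric.ball (0 : E n) φ.rOut
  · rw [h (x - t)]
    rw [mem_ball_zero_iff] at ht
    simpa [dist_eq_norm] using ht.le
  · rw [← φ.support_normed_eq (μ := volume), Function.notMem_support] at ht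
    simp [ht]

/-- The derivative falls on the kernel, and t ↦ φ(x - t) is itself a test function, so the
definition of the weak derivative moves it onto `g`. The sign from x - t cancels the sign of the
integration by parts. -/
lemma fderiv_mollify (φ : ContDiffBump (0 : E n)) {a : E n} {u g : E n → ℝ}
    (h : HasWeakDir a u g) (x : E n) :
    fderiv ℝ (mollify φ u) x a = mollify φ g x := by
  have hφ1 : ContDiff ℝ 1 (φ.normed (volume : Measure (E n))) := φ.contDiff_normed
  have h1 := φ.hasCompactSupport_normed.hasFDerivAt_convolution_left
    (ContinuousLinearMap.lsmul ℝ ℝ) hφ1 h.1 x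
  have h2 : fderiv ℝ (mollify φ u) x = _ := h1.fderiv
  have hex := (φ.hasCompactSupport_normed.fderiv (𝕜 := ℝ)).convolutionExists_left
    ((ContinuousLinearMap.lsmul ℝ ℝ).precompL (E n))
    (hφ1.continuous_fderiv one_ne_zero) h.1 x
  rw [h2, convolution_eq_swap]
  have h3 := ContinuousLinearMap.integral_apply hex.integrable_swap a
  refine h3.trans ?_
  rw [mollify_apply_swap]
  set ψ : E n → ℝ := fun t => φ.normed volume (x - t) with hψ
  have hψs : ContDiff ℝ ∞ ψ := φ.contDiff_normed.comp (contDiff_const.sub contDiff_id)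
  have hψc : HasCompactSupport ψ :=
    φ.hasCompactSupport_normed.comp_homeomorph (Homeomorph.subLeft x)
  have hd : ∀ t, fderiv ℝ ψ t a = -fderiv ℝ (φ.normed volume) (x - t) a := by
    intro t
    have e := ((hφ1.differentiable one_ne_zero (x - t)).hasFDerivAt.comp t
      ((hasFDerivAt_id t).const_sub x)).fderiv
    have e' : fderiv ℝ ψ t = _ := e
    rw [e']; simp
  have key := h.2.2 ψ hψs hψc
  simp only [hd, mul_neg, integral_neg, neg_inj] at key
  calc _ = ∫ t, u t * fderiv ℝ (φ.normed volume) (x - t) a := by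
        congr 1; ext t; simp [ContinuousLinearMap.precompL_apply, mul_comm]
    _ = _ := key
    _ = _ := by simp only [hψ, mul_comm]

/-- A sequence of bump functions with radii tending to zero. -/
def bumpSeq (n k : ℕ) : ContDiffBump (0 : E n) where
  -- The fixed ratio 2 of the radii is what the almost everywhere convergence theorem requires;
  -- radii at most 1 let supports be enlarged by 1 below.
  rIn := 1 / (k + 1) / 2
  rOut := 1 / (k + 1)
  rIn_pos := by positivity
  rIn_lt_rOut := half_lt_self (by positivity)

lemma bumpSeq_rOut_le (n k : ℕ) : (bumpSeq n k).rOut ≤ 1 := by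
  change (1 : ℝ) / (k + 1) ≤ 1
  rw [div_le_one (by positivity)]
  linarith [(Nat.cast_nonneg k : (0 : ℝ) ≤ k)]

lemma tendsto_bumpSeq_rOut (n : ℕ) : Tendsto (fun k => (bumpSeq n k).rOut) atTop (𝓝 0) :=
  tendsto_one_div_add_atTop_nhds_zero_nat

lemma ae_tendsto_mollify {u : E n → ℝ} (hu : LocallyIntegrable u) :
    ∀ᵐ x, Tendsto (fun k => mollify (bumpSeq n k) u x) atTop (𝓝 (u x)) :=
  ContDiffBump.ae_convolution_tendsto_right_of_locallyIntegrable (K := 2) (tendsto_bumpSeq_rOut n)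
    (Eventually.of_forall fun k => by
      change (1 : ℝ) / (k + 1) ≤ 2 * (1 / (k + 1) / 2)
      linarith) hu

lemma tendsto_integral_abs_mollify_sub_of_continuous {h : E n → ℝ} (hh : Continuous h)
    (hc : HasCompactSupport h) :
    Tendsto (fun k => ∫ x, |mollify (bumpSeq n k) h x - h x|) atTop (𝓝 0) := by
  obtain ⟨C, hC⟩ := hc.exists_bound_of_continuous hh
  obtain ⟨R, hR⟩ := hc.isCompact.isBounded.subset_closedBall (0 : E n)
  have h0 : ∀ x, x ∉ Metric.closedBall (0 : E n) R → h x = 0 := fun x hx =>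
    image_eq_zero_of_notMem_tsupport fun h' => hx (hR h')
  have hcont : ∀ k, Continuous (mollify (bumpSeq n k) h) := fun k =>
    (contDiff_mollify _ hh.locallyIntegrable).continuous
  rw [← integral_zero (E n) ℝ (μ := volume)]
  refine tendsto_integral_of_dominated_convergence
    ((Metric.closedBall (0 : E n) (R + 1)).indicator fun _ => 2 * C)
    (fun k => ((hcont k).sub hh).abs.aestronglyMeasurable) ?_ ?_ ?_
  · rw [integrable_indicator_iff Metric.isClosed_closedBall.measurableSet]
    exact integrableOn_const (isCompact_closedBall _ _).measure_lt_top.ne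
  · refine fun k => Eventually.of_forall fun x => ?_
    by_cases hx : x ∈ Metric.closedBall (0 : E n) (R + 1)
    · rw [Set.indicator_of_mem hx, norm_abs_eq_norm]
      have e1 := abs_mollify_le_of_ae (bumpSeq n k) (Eventually.of_forall hC) x
      have e2 := hC x
      rw [← Real.norm_eq_abs] at e1
      linarith [norm_sub_le (mollify (bumpSeq n k) h x) (h x)]
    · rw [Set.indicator_of_notMem hx]
      rw [mem_closedBall_zero_iff, not_le] at hx
      have e1 : mollify (bumpSeq n k) h x = mollify (bumpSeq n k) (fun _ => 0) x := by
        refine mollify_congr_of_ball _ fun y hy => h0 y ?_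
        rw [mem_closedBall_zero_iff, not_le]
        have := bumpSeq_rOut_le n k
        have := norm_sub_norm_le x y
        rw [dist_eq_norm] at hy
        linarith
      rw [e1, h0 x (by rw [mem_closedBall_zero_iff, not_le]; linarith)]
      simp [mollify_apply]
  · refine Eventually.of_forall fun x => ?_
    have := ContDiffBump.convolution_tendsto_right_of_continuous (μ := volume)
      (tendsto_bumpSeq_rOut n) hh x
    have := (this.sub_const (h x)).abs
    simpa [mollify] using this

/-- Density of continuous compactly supported functions: mollification contracts the L¹ norm, so the
error is at most ε/4 + ε/4 from the approximation plus ε/2 from the continuous case. -/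
lemma tendsto_integral_abs_mollify_sub {g : E n → ℝ} (hg : Integrable g) :
    Tendsto (fun k => ∫ x, |mollify (bumpSeq n k) g x - g x|) atTop (𝓝 0) := by
  rw [Metric.tendsto_atTop]
  intro ε hε
  obtain ⟨h, hc, hgh, hh, hhi⟩ := hg.exists_hasCompactSupport_integral_sub_le
    (show 0 < ε / 4 by positivity)
  obtain ⟨N, hN⟩ := Metric.tendsto_atTop.1
    (tendsto_integral_abs_mollify_sub_of_continuous hh hc) (ε / 2) (by positivity)
  refine ⟨N, fun k hk => ?_⟩
  have h1 := hN k hk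
  rw [Real.dist_0_eq_abs, abs_of_nonneg (integral_nonneg fun _ => abs_nonneg _)] at h1 ⊢
  set φ := bumpSeq n k
  have hgh' : Integrable fun x => g x - h x := hg.sub hhi
  have h2 := integral_abs_mollify_le φ hgh'
  have hdec : ∀ x, mollify φ g x = mollify φ (fun y => g y - h y) x + mollify φ h x := by
    intro x
    rw [← mollify_add φ hgh'.locallyIntegrable hhi.locallyIntegrable]
    simp
  have hi1 : Integrable fun x => |mollify φ (fun y => g y - h y) x| :=
    (integrable_mollify φ hgh').abs
  have hi2 : Integrable fun x => |mollify φ h x - h x| := ((integrable_mollify φ hhi).sub hhi).abs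
  have hi12 : Integrable fun x =>
    |mollify φ (fun y => g y - h y) x| + |mollify φ h x - h x| := hi1.add hi2
  have h3 : ∫ x, |mollify φ g x - g x| ≤ ∫ x, ((|mollify φ (fun y => g y - h y) x| +
      |mollify φ h x - h x|) + |g x - h x|) := by
    refine integral_mono ((integrable_mollify φ hg).sub hg).abs (hi12.add hgh'.abs) fun x => ?_
    simp only [hdec x]
    have e : mollify φ (fun y => g y - h y) x + mollify φ h x - g x =
      mollify φ (fun y => g y - h y) x + (mollify φ h x - h x) + -(g x - h x) := by ring
    rw [e]
    refine (abs_add_le _ _).trans ?_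
    rw [abs_neg]
    gcongr
    exact abs_add_le _ _
  rw [integral_add hi12 hgh'.abs, integral_add hi1 hi2] at h3
  simp only [Real.norm_eq_abs] at hgh
  linarith

/-- The kernels reach no further than distance 1, so on the ball of radius R the function may be
truncated to the ball of radius R + 1. -/
lemma tendsto_setIntegral_abs_mollify_sub {g : E n → ℝ} (hg : LocallyIntegrable g) (R : ℝ) :
    Tendsto (fun k => ∫ x in Metric.closedBall (0 : E n) R, |mollify (bumpSeq n k) g x - g x|)
      atTop (𝓝 0) := by
  set B := Metric.closedBall (0 : E n) (R + 1)
  have hB : MeasurableSet B := Metric.isClosed_closedBall.measurableSet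
  have hgi : Integrable (B.indicator g) :=
    (integrable_indicator_iff hB).2 (hg.integrableOn_isCompact (isCompact_closedBall _ _))
  refine squeeze_zero (fun k => integral_nonneg fun _ => abs_nonneg _) (fun k => ?_)
    (tendsto_integral_abs_mollify_sub hgi)
  rw [setIntegral_congr_fun (g := fun x => |mollify (bumpSeq n k) (B.indicator g) x -
    B.indicator g x|) Metric.isClosed_closedBall.measurableSet ?_]
  · exact setIntegral_le_integral ((integrable_mollify _ hgi).sub hgi).abs
      (Eventually.of_forall fun _ => abs_nonneg _)
  · intro x hx
    rw [mem_closedBall_zero_iff] at hx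
    have hxB : x ∈ B := by rw [mem_closedBall_zero_iff]; linarith
    simp only
    rw [Set.indicator_of_mem hxB, mollify_congr_of_ball]
    intro y hy
    rw [Set.indicator_of_mem]
    rw [mem_closedBall_zero_iff]
    have := bumpSeq_rOut_le n k
    have := norm_sub_norm_le y x
    rw [dist_comm, dist_eq_norm] at hy
    linarith

end Mollification

/-! ### Chain rule for weak derivatives -/

section ChainRule

open Filter Topology

/-- The chain rule for weak derivatives of bounded functions. -/
lemma HasWeakDir.comp_contDiff {a : E n} {u g : E n → ℝ} (h : HasWeakDir a u g) {f : ℝ → ℝ}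
    (hf : ContDiff ℝ 1 f) {K : ℝ} (hK : ∀ᵐ x, |u x| ≤ K) :
    HasWeakDir a (fun x => f (u x)) (fun x => deriv f (u x) * g x) := by
  have hf' : Continuous (deriv f) := hf.continuous_deriv le_rfl
  obtain ⟨C, hC⟩ := (isCompact_Icc (a := -K) (b := K)).exists_bound_of_continuousOn
    hf.continuous.continuousOn
  obtain ⟨C', hC'⟩ := (isCompact_Icc (a := -K) (b := K)).exists_bound_of_continuousOn
    hf'.continuousOn
  have hum := h.1.aestronglyMeasurable
  have hgm := h.2.1.aestronglyMeasurable
  have hfu := hf.continuous.comp_aestronglyMeasurable hum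
  have hfu' := hf'.comp_aestronglyMeasurable hum
  have hCu : ∀ᵐ x, ‖f (u x)‖ ≤ C := by
    filter_upwards [hK] with x hx using hC _ (abs_le.1 hx)
  have hCu' : ∀ᵐ x, ‖deriv f (u x)‖ ≤ C' := by
    filter_upwards [hK] with x hx using hC' _ (abs_le.1 hx)
  refine ⟨(memLp_top_of_bound hfu C hCu).locallyIntegrable le_top, ?_, fun φ hφ hc => ?_⟩
  · refine (h.2.1.smul C').mono (hfu'.mul hgm) ?_
    filter_upwards [hCu'] with x hx
    simp only [Pi.smul_apply, smul_eq_mul, norm_mul]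
    exact mul_le_mul_of_nonneg_right (hx.trans (le_abs_self _)) (norm_nonneg _)
  have hφ1 : ContDiff ℝ 1 φ := hφ.of_le (by exact_mod_cast le_top)
  obtain ⟨D, hD⟩ := hc.exists_bound_of_continuous hφ.continuous
  obtain ⟨R, hR⟩ := hc.isCompact.isBounded.subset_closedBall (0 : E n)
  have h0 : ∀ x, x ∉ Metric.closedBall (0 : E n) R → φ x = 0 := fun x hx =>
    image_eq_zero_of_notMem_tsupport fun h' => hx (hR h')
  have hDint : Integrable fun x => fderiv ℝ φ x a :=
    (continuous_fderiv_apply_const hφ1 a).integrable_of_hasCompactSupport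
      (hc.fderiv_apply (𝕜 := ℝ) a)
  have hgφ := integrable_mul_test h.2.1 hφ.continuous hc
  -- The formula is classical for the smooth `U k`, whose derivative along `a` is `G k`; it remains
  -- to pass to the limit.
  set U : ℕ → E n → ℝ := fun k => mollify (bumpSeq n k) u with hU
  set G : ℕ → E n → ℝ := fun k => mollify (bumpSeq n k) g with hG
  have hUs : ∀ k, ContDiff ℝ 1 (U k) := fun k =>
    (contDiff_mollify _ h.1).of_le (by exact_mod_cast le_top)
  have hGc : ∀ k, Continuous (G k) := fun k => (contDiff_mollify _ h.2.1).continuous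
  have hUK : ∀ k x, U k x ∈ Set.Icc (-K) K := fun k x =>
    abs_le.1 (abs_mollify_le_of_ae _ hK x)
  have hparts : ∀ k, ∫ x, f (U k x) * fderiv ℝ φ x a = -∫ x, deriv f (U k x) * G k x * φ x := by
    intro k
    refine (integral_mul_fderiv_of_contDiff (hf.comp (hUs k)) hφ1 hc a).trans ?_
    congr 2
    ext x
    have e : fderiv ℝ (fun y => f (U k y)) x a = deriv f (U k x) * G k x := by
      have e1 := ((hf.differentiable one_ne_zero (U k x)).hasDerivAt.comp_hasFDerivAt x
        ((hUs k).differentiable one_ne_zero x).hasFDerivAt).fderiv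
      have e2 : fderiv ℝ (fun y => f (U k y)) x = _ := e1
      rw [e2, _root_.smul_apply, smul_eq_mul, fderiv_mollify _ h]
    rw [← e]; rfl
  have lim1 : Tendsto (fun k => ∫ x, f (U k x) * fderiv ℝ φ x a) atTop
      (𝓝 (∫ x, f (u x) * fderiv ℝ φ x a)) := by
    refine tendsto_integral_of_dominated_convergence (fun x => C * ‖fderiv ℝ φ x a‖)
      (fun k => ((hf.continuous.comp (hUs k).continuous).mul
        (continuous_fderiv_apply_const hφ1 a)).aestronglyMeasurable)
      (hDint.norm.const_mul C) (fun k => Eventually.of_forall fun x => ?_) ?_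
    · rw [norm_mul]
      exact mul_le_mul_of_nonneg_right (hC _ (hUK k x)) (norm_nonneg _)
    · filter_upwards [ae_tendsto_mollify h.1] with x hx
      exact ((hf.continuous.tendsto _).comp hx).mul_const _
  -- `G k` is split as g + (G k - g): the first part converges by domination, the second tends to 0
  -- because `G k` → g in L¹ on the support of φ while f'(U k) stays bounded.
  have hint2 : ∀ k, Integrable fun x => deriv f (U k x) * (g x * φ x) := fun k =>
    hgφ.bdd_mul (hf'.comp (hUs k).continuous).aestronglyMeasurable
      (Eventually.of_forall fun x => hC' _ (hUK k x))
  have lim2 : Tendsto (fun k => ∫ x, deriv f (U k x) * (g x * φ x)) atTop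
      (𝓝 (∫ x, deriv f (u x) * (g x * φ x))) := by
    refine tendsto_integral_of_dominated_convergence (fun x => C' * ‖g x * φ x‖)
      (fun k => (hint2 k).aestronglyMeasurable)
      (hgφ.norm.const_mul C') (fun k => Eventually.of_forall fun x => ?_) ?_
    · rw [norm_mul]
      exact mul_le_mul_of_nonneg_right (hC' _ (hUK k x)) (norm_nonneg _)
    · filter_upwards [ae_tendsto_mollify h.1] with x hx
      exact ((hf'.tendsto _).comp hx).mul_const _
  have hint3 : ∀ k, Integrable fun x => deriv f (U k x) * ((G k x - g x) * φ x) := fun k =>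
    (integrable_mul_test ((hGc k).locallyIntegrable.sub h.2.1) hφ.continuous hc).bdd_mul
      (hf'.comp (hUs k).continuous).aestronglyMeasurable
      (Eventually.of_forall fun x => hC' _ (hUK k x))
  have lim3 : Tendsto (fun k => ∫ x, deriv f (U k x) * ((G k x - g x) * φ x)) atTop (𝓝 0) := by
    have hlim := (tendsto_setIntegral_abs_mollify_sub h.2.1 R).const_mul (C' * D)
    rw [mul_zero] at hlim
    refine squeeze_zero_norm (fun k => ?_) hlim
    have hset : ∫ x, deriv f (U k x) * ((G k x - g x) * φ x) =
        ∫ x in Metric.closedBall (0 : E n) R, deriv f (U k x) * ((G k x - g x) * φ x) := by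
      refine (setIntegral_eq_integral_of_forall_compl_eq_zero fun x hx => ?_).symm
      rw [h0 x hx]; ring
    rw [hset, ← integral_const_mul]
    refine norm_integral_le_of_norm_le ?_ (Eventually.of_forall fun x => ?_)
    · exact ((((hGc k).locallyIntegrable.sub h.2.1).integrableOn_isCompact
        (isCompact_closedBall _ _)).abs).const_mul _
    · have hC0 : 0 ≤ C' := (norm_nonneg _).trans (hC' _ (hUK k x))
      rw [norm_mul, norm_mul, ← Real.norm_eq_abs]
      calc _ ≤ C' * (‖G k x - g x‖ * D) := by
            gcongr
            · exact hC' _ (hUK k x)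
            · exact hD x
        _ = _ := by ring
  have lim4 : Tendsto (fun k => ∫ x, deriv f (U k x) * G k x * φ x) atTop
      (𝓝 (∫ x, deriv f (u x) * g x * φ x)) := by
    have hsum := lim2.add lim3
    simp only [add_zero, ← mul_assoc] at hsum
    refine hsum.congr fun k => ?_
    have h2 := hint2 k
    have h3 := hint3 k
    simp only [← mul_assoc] at h2 h3
    rw [← integral_add h2 h3]
    congr 1; ext x; ring
  refine tendsto_nhds_unique lim1 ?_
  simp only [hparts]
  exact lim4.neg

end ChainRule

/-! ### Well-definedness of the weak operator -/

lemma contDiff_abs_rpow {p : ℝ} (hp : 1 < p) : ContDiff ℝ 1 (fun y : ℝ => |y| ^ p) := by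
  simpa using contDiff_norm_rpow (E := ℝ) hp

lemma ae_abs_le_of_memLp_top {u : E n → ℝ} (hu : MemLp u ⊤) : ∃ K : ℝ, ∀ᵐ x, |u x| ≤ K := by
  refine ⟨(eLpNorm u ⊤ volume).toReal, ?_⟩
  filter_upwards [ae_le_eLpNormEssSup (f := u) (μ := volume)] with x hx
  rw [← eLpNorm_exponent_top] at hx
  have := ENNReal.toReal_mono hu.2.ne hx
  simpa using this

/-- `|u|ᵖ` of a function `u ∈ L^∞` with weak derivative in `L²` has its weak derivative in `L²`. -/
lemma exists_hasWeakDir_abs_rpow {p : ℝ} (hp : 1 < p) {a : E n} {u g : E n → ℝ}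
    (h : HasWeakDir a u g) (hu : MemLp u ⊤) (hg : MemLp g 2) :
    ∃ w, MemLp w 2 ∧ HasWeakDir a (fun x => |u x| ^ p) w := by
  obtain ⟨K, hK⟩ := ae_abs_le_of_memLp_top hu
  have hf := contDiff_abs_rpow hp
  have hf' : Continuous (deriv fun y : ℝ => |y| ^ p) := hf.continuous_deriv le_rfl
  refine ⟨_, ?_, h.comp_contDiff hf hK⟩
  obtain ⟨C', hC'⟩ := (isCompact_Icc (a := -K) (b := K)).exists_bound_of_continuousOn
    hf'.continuousOn
  refine (hg.const_mul C').mono ((hf'.comp_aestronglyMeasurable hu.1).mul hg.1) ?_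
  filter_upwards [hK] with x hx
  rw [norm_mul, norm_mul]
  exact mul_le_mul_of_nonneg_right ((hC' _ (abs_le.1 hx)).trans (le_abs_self _)) (norm_nonneg _)

/-- The value of `F(u)` does not depend on the choice of the weak derivatives. -/
lemma IsBurgersL2.ae_eq {ν p : ℝ} {u : E n → ℝ} {f : Lp ℝ 2 (volume : Measure (E n))}
    (hf : IsBurgersL2 ν p u f) {g h : Fin (n + 1) → E n → ℝ} {w : E n → ℝ}
    (hg : ∀ i, HasWeakPartial i u (g i)) (hh : ∀ i, HasWeakPartial i (g i) (h i))
    (hw : HasWeakPartial 0 (fun x => |u x| ^ p) w) :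
    f =ᵐ[volume] fun x => ν * ∑ i, h i x - 1 / p * w x := by
  obtain ⟨g', h', w', hg', hh', hw', e'⟩ := hf
  have e1 : ∀ᵐ x, ∀ i, h i x = h' i x := by
    rw [ae_all_iff]
    intro i
    have e2 : g' i =ᵐ[volume] g i := HasWeakDir.unique (hg' i) (hg i)
    exact HasWeakDir.unique (hh i) (HasWeakDir.congr_ae (hh' i) e2 Filter.EventuallyEq.rfl)
  filter_upwards [e1, HasWeakDir.unique hw hw', e'] with x h1 h2 h3
  rw [h3, h2]
  simp only [h1]

lemma IsBurgersL2.unique {ν p : ℝ} {u : E n → ℝ} {f f' : Lp ℝ 2 (volume : Measure (E n))}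
    (hf : IsBurgersL2 ν p u f) (hf' : IsBurgersL2 ν p u f') : f = f' := by
  obtain ⟨g, h, w, hg, hh, hw, e⟩ := hf
  exact Lp.ext (e.trans (hf'.ae_eq hg hh hw).symm)

lemma exists_isBurgersL2 {p : ℝ} (ν : ℝ) (hp : 1 < p) {u : E n → ℝ} (hu : MemH2Linf u) :
    ∃ f : Lp ℝ 2 (volume : Measure (E n)), IsBurgersL2 ν p u f := by
  obtain ⟨⟨-, g, h, hg, hh⟩, hui⟩ := hu
  obtain ⟨w, hw2, hw⟩ := exists_hasWeakDir_abs_rpow hp (hg 0).2 hui (hg 0).1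
  have hmem : MemLp (fun x => ν * ∑ i, h i i x - 1 / p * w x) 2 :=
    ((memLp_finsetSum _ fun i _ => (hh i i).1).const_mul ν).sub (hw2.const_mul (1 / p))
  exact ⟨hmem.toLp _, g, fun i => h i i, w, fun i => (hg i).2, fun i => (hh i i).2, hw,
    hmem.coeFn_toLp⟩

lemma existsUnique_isBurgersL2 {p : ℝ} (ν : ℝ) (hp : 1 < p) {u : E n → ℝ} (hu : MemH2Linf u) :
    ∃! f : Lp ℝ 2 (volume : Measure (E n)), IsBurgersL2 ν p u f :=
  let ⟨f, hf⟩ := exists_isBurgersL2 ν hp hu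
  ⟨f, hf, fun _ hf' => hf'.unique hf⟩

/-! ### Linear algebra of the condition on M and c -/

section BlockMatrix

open Matrix

lemma blockOne_mul (A B : Matrix (Fin n) (Fin n) ℝ) :
    blockOne A * blockOne B = blockOne (A * B) := by
  ext i j
  refine Fin.cases ?_ (fun i => ?_) i <;> refine Fin.cases ?_ (fun j => ?_) j <;>
    simp [Matrix.mul_apply, blockOne, Fin.sum_univ_succ]

lemma blockOne_one : blockOne (1 : Matrix (Fin n) (Fin n) ℝ) = 1 := by
  ext i j
  refine Fin.cases ?_ (fun i => ?_) i <;> refine Fin.cases ?_ (fun j => ?_) j <;>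
    simp [blockOne, Matrix.one_apply, Fin.succ_ne_zero, (Fin.succ_ne_zero _).symm]

lemma transpose_blockOne (A : Matrix (Fin n) (Fin n) ℝ) : (blockOne A)ᵀ = blockOne Aᵀ := by
  ext i j
  refine Fin.cases ?_ (fun i => ?_) i <;> refine Fin.cases ?_ (fun j => ?_) j <;>
    simp [blockOne]

/-- The condition on `M` and `c`, expressed by the entries of `M⁻¹`. -/
lemma inv_mul_transpose_iff {M : Matrix (Fin (n + 1)) (Fin (n + 1)) ℝ} (hM : IsUnit M) {r c : ℝ}
    (hr : 0 < r) :
    (M⁻¹ * M⁻¹ᵀ = c • (1 : Matrix (Fin (n + 1)) (Fin (n + 1)) ℝ) ∧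
        ∀ k, M⁻¹ k 0 = if k = 0 then c * r else 0) ↔
      (∃ Q ∈ Matrix.orthogonalGroup (Fin n) ℝ, M = r • blockOne Q) ∧ c = (r ^ 2)⁻¹ := by
  have hMd := (Matrix.isUnit_iff_isUnit_det M).1 hM
  have hMN : M * M⁻¹ = 1 := Matrix.mul_nonsing_inv _ hMd
  constructor
  · rintro ⟨h1, h2⟩
    set N := M⁻¹ with hN
    have hNt : Nᵀ = c • M := by
      have := congrArg (M * ·) h1
      simpa [← Matrix.mul_assoc, hMN] using this
    have hNtN : Nᵀ * N = c • (1 : Matrix (Fin (n + 1)) (Fin (n + 1)) ℝ) := by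
      rw [hNt, Matrix.smul_mul, hMN]
    have hc : c ≠ 0 := by
      rintro rfl
      rw [zero_smul, Matrix.transpose_eq_zero] at hNt
      rw [hNt, mul_zero] at hMN
      exact zero_ne_one hMN
    -- Row 0 of NᵀN = c·1, since column 0 of N is c r e₀. The entry k = 0 gives c²r² = c, hence c =
    -- r⁻²; the others clear row 0 of N, and M = r²Nᵀ becomes block diagonal.
    have hrow : ∀ k, c * r * N 0 k = if k = 0 then c else 0 := by
      intro k
      have := congrFun (congrFun hNtN 0) k
      simpa [Matrix.mul_apply, h2, Matrix.one_apply, eq_comm] using this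
    have hcr : c = (r ^ 2)⁻¹ := by
      have := hrow 0
      rw [h2 0, if_pos rfl, if_pos rfl] at this
      have h3 : c * (c * r ^ 2 - 1) = 0 := by linarith
      have h4 : c * r ^ 2 - 1 = 0 := (mul_eq_zero.1 h3).resolve_left hc
      exact eq_inv_of_mul_eq_one_left (by linarith)
    have hMe : ∀ i j, M i j = r ^ 2 * N j i := by
      intro i j
      have := congrFun (congrFun hNt i) j
      rw [Matrix.transpose_apply, Matrix.smul_apply, smul_eq_mul, hcr] at this
      rw [this]; field_simp
    have hM0 : ∀ k, M 0 k = if k = 0 then r else 0 := by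
      intro k
      rw [hMe, h2 k, hcr]
      split_ifs
      · field_simp
      · simp
    have hMk : ∀ i : Fin n, M i.succ 0 = 0 := by
      intro i
      have := hrow i.succ
      rw [if_neg (Fin.succ_ne_zero i)] at this
      rw [hMe, (mul_eq_zero.1 this).resolve_left (mul_ne_zero hc hr.ne'), mul_zero]
    have hMMt : M * Mᵀ = r ^ 2 • (1 : Matrix (Fin (n + 1)) (Fin (n + 1)) ℝ) := by
      have hMt : Mᵀ = r ^ 2 • N := by
        ext i j; simp [hMe]
      rw [hMt, Matrix.mul_smul, hMN]
    refine ⟨⟨Matrix.of fun i j => r⁻¹ * M i.succ j.succ, ?_, ?_⟩, hcr⟩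
    · rw [Matrix.mem_orthogonalGroup_iff]
      ext i j
      have := congrFun (congrFun hMMt i.succ) j.succ
      simp only [Matrix.mul_apply, Fin.sum_univ_succ, Matrix.transpose_apply, hMk, zero_mul,
        zero_add, Matrix.smul_apply, smul_eq_mul, Matrix.one_apply, Fin.succ_inj] at this
      simp only [Matrix.mul_apply, Matrix.transpose_apply, Matrix.of_apply, Matrix.one_apply]
      calc _ = r⁻¹ ^ 2 * ∑ k : Fin n, M i.succ k.succ * M j.succ k.succ := by
            rw [Finset.mul_sum]; exact Finset.sum_congr rfl fun k _ => by ring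
        _ = _ := by rw [this]; field_simp
    · ext i j
      refine Fin.cases ?_ (fun i => ?_) i <;> refine Fin.cases ?_ (fun j => ?_) j <;>
        simp [blockOne, hM0, hMk, Fin.succ_ne_zero, hr.ne']
  · rintro ⟨⟨Q, hQ, rfl⟩, rfl⟩
    have hQ1 : Q * Qᵀ = 1 := by
      simpa [Matrix.star_eq_conjTranspose] using (Matrix.mem_orthogonalGroup_iff (Fin n) ℝ).1 hQ
    have hQ2 : Qᵀ * Q = 1 := by
      simpa [Matrix.star_eq_conjTranspose] using (Matrix.mem_orthogonalGroup_iff' (Fin n) ℝ).1 hQ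
    have hN : (r • blockOne Q)⁻¹ = r⁻¹ • blockOne Qᵀ := by
      refine Matrix.inv_eq_right_inv ?_
      rw [Matrix.smul_mul, Matrix.mul_smul, blockOne_mul, hQ1, blockOne_one, smul_smul,
        mul_inv_cancel₀ hr.ne', one_smul]
    rw [hN]
    constructor
    · rw [Matrix.transpose_smul, transpose_blockOne, Matrix.smul_mul, Matrix.mul_smul,
        blockOne_mul, Matrix.transpose_transpose, hQ2, blockOne_one, smul_smul]
      congr 1; field_simp
    · intro k
      refine Fin.cases ?_ (fun k => ?_) k
      · simp [blockOne]; field_simp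
      · simp [blockOne, Fin.succ_ne_zero]

end BlockMatrix

/-! ### The classical operator: transformation rule and test polynomials -/

section Classical

lemma fderiv_transform {α : ℝ} (M : Matrix (Fin (n + 1)) (Fin (n + 1)) ℝ) (b a : E n)
    {v : E n → ℝ} (hv : Differentiable ℝ v) (x : E n) :
    fderiv ℝ (transform α M b v) x a =
      transform α M b (fun y => fderiv ℝ v y (Matrix.toEuclideanLin M⁻¹ a)) x := by
  have hd : DifferentiableAt ℝ (fun y => v (backward M b y)) x :=
    (hv _).comp x (hasFDerivAt_backward M b x).differentiableAt
  have h1 : fderiv ℝ (transform α M b v) x = α⁻¹ • fderiv ℝ (fun y => v (backward M b y)) x :=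
    fderiv_const_mul hd α⁻¹
  rw [h1, _root_.smul_apply, smul_eq_mul, fderiv_comp_backward M b x a (hv _)]
  rfl

lemma contDiff_fderiv_apply_const {v : E n → ℝ} (hv : ContDiff ℝ 2 v) (a : E n) :
    ContDiff ℝ 1 fun y => fderiv ℝ v y a :=
  (hv.fderiv_right (m := 1) (by norm_num)).clm_apply contDiff_const

lemma laplacian_eq_sum {v : E n → ℝ} (hv : ContDiff ℝ 2 v) (x : E n) :
    Laplacian.laplacian v x =
      ∑ i, fderiv ℝ (fun y => fderiv ℝ v y (unitVec i)) x (unitVec i) := by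
  rw [InnerProductSpace.laplacian_eq_iteratedFDeriv_orthonormalBasis v
    (EuclideanSpace.basisFun (Fin (n + 1)) ℝ)]
  refine Finset.sum_congr rfl fun i _ => ?_
  have hd : DifferentiableAt ℝ (fderiv ℝ v) x :=
    (hv.fderiv_right (m := 1) (by norm_num)).differentiable one_ne_zero x
  rw [iteratedFDeriv_two_apply, fderiv_clm_apply hd (differentiableAt_const _)]
  simp [unitVec]

lemma laplacian_transform {α : ℝ} (M : Matrix (Fin (n + 1)) (Fin (n + 1)) ℝ) (b : E n)
    {v : E n → ℝ} (hv : ContDiff ℝ 2 v) (x : E n) :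
    Laplacian.laplacian (transform α M b v) x =
      α⁻¹ * ∑ i, fderiv ℝ (fun y => fderiv ℝ v y (Matrix.toEuclideanLin M⁻¹ (unitVec i)))
        (backward M b x) (Matrix.toEuclideanLin M⁻¹ (unitVec i)) := by
  rw [laplacian_eq_sum (contDiff_transform M b α hv), Finset.mul_sum]
  refine Finset.sum_congr rfl fun i _ => ?_
  simp only [fderiv_transform M b (unitVec i) (hv.differentiable two_ne_zero)]
  exact fderiv_transform M b (unitVec i)
    ((contDiff_fderiv_apply_const hv _).differentiable one_ne_zero) x

/-- The nonlinearity is again a transformed function, with αᵖ in place of α, so the first-order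
rules for `transform` apply to it. -/
lemma abs_transform_rpow {α : ℝ} (hα : 0 < α) (p : ℝ)
    (M : Matrix (Fin (n + 1)) (Fin (n + 1)) ℝ) (b : E n) (v : E n → ℝ) :
    (fun x => |transform α M b v x| ^ p) = transform (α ^ p) M b fun y => |v y| ^ p := by
  ext x
  simp only [transform]
  rw [abs_mul, Real.mul_rpow (abs_nonneg _) (abs_nonneg _), abs_of_pos (inv_pos.2 hα),
    Real.inv_rpow hα.le]

lemma contDiff_comp_abs_rpow {p : ℝ} (hp : 1 < p) {v : E n → ℝ} (hv : ContDiff ℝ 1 v) :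
    ContDiff ℝ 1 fun y => |v y| ^ p := (contDiff_abs_rpow hp).comp hv

lemma burgersOp_transform {ν p α : ℝ} (hp : 1 < p) (hα : 0 < α)
    (M : Matrix (Fin (n + 1)) (Fin (n + 1)) ℝ) (b : E n)
    {v : E n → ℝ} (hv : ContDiff ℝ 2 v) (x : E n) :
    burgersOp ν p (transform α M b v) x =
      ν * (α⁻¹ * ∑ i, fderiv ℝ (fun y => fderiv ℝ v y (Matrix.toEuclideanLin M⁻¹ (unitVec i)))
        (backward M b x) (Matrix.toEuclideanLin M⁻¹ (unitVec i))) -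
      1 / p * ((α ^ p)⁻¹ * fderiv ℝ (fun y => |v y| ^ p) (backward M b x)
        (Matrix.toEuclideanLin M⁻¹ (unitVec 0))) := by
  rw [burgersOp, laplacian_transform M b hv, abs_transform_rpow hα, fderiv_transform M b _
    ((contDiff_comp_abs_rpow hp (hv.of_le one_le_two)).differentiable one_ne_zero)]
  rfl

lemma continuous_burgersOp {p : ℝ} (ν : ℝ) (hp : 1 < p) {u : E n → ℝ} (hu : ContDiff ℝ 2 u) :
    Continuous (burgersOp ν p u) := by
  have h1 : Continuous fun x => Laplacian.laplacian u x := by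
    simp only [laplacian_eq_sum hu]
    exact continuous_finsetSum _ fun i _ =>
      continuous_fderiv_apply_const (contDiff_fderiv_apply_const hu _) _
  exact (h1.const_mul ν).sub ((continuous_fderiv_apply_const
    (contDiff_comp_abs_rpow hp (hu.of_le one_le_two)) _).const_mul (1 / p))

lemma burgersOp_congr_nhds {ν p : ℝ} {u w : E n → ℝ} {x : E n} (h : u =ᶠ[nhds x] w) :
    burgersOp ν p u x = burgersOp ν p w x := by
  have h1 := (InnerProductSpace.laplacian_congr_nhds h).eq_of_nhds
  have h2 : (fun y => |u y| ^ p) =ᶠ[nhds x] fun y => |w y| ^ p := by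
    filter_upwards [h] with y hy; rw [hy]
  rw [burgersOp, burgersOp, h1, h2.fderiv_eq]

/-- Summation of a quadratic form over the columns of `N` with `N Nᵀ = c`. -/
lemma sum_sum_mul_eq_of_mul_transpose {N : Matrix (Fin (n + 1)) (Fin (n + 1)) ℝ} {c : ℝ}
    (hN : N * N.transpose = c • (1 : Matrix (Fin (n + 1)) (Fin (n + 1)) ℝ))
    (H : Fin (n + 1) → Fin (n + 1) → ℝ) :
    ∑ i, ∑ k, N k i * ∑ l, N l i * H k l = c * ∑ k, H k k := by
  have hN' : ∀ k l, ∑ i, N k i * N l i = if k = l then c else 0 := by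
    intro k l
    have := congrFun (congrFun hN k) l
    simpa [Matrix.mul_apply, Matrix.one_apply] using this
  calc _ = ∑ k, ∑ l, (∑ i, N k i * N l i) * H k l := by
        rw [Finset.sum_comm]
        refine Finset.sum_congr rfl fun k _ => ?_
        simp only [Finset.mul_sum, Finset.sum_mul]
        rw [Finset.sum_comm]
        exact Finset.sum_congr rfl fun l _ => Finset.sum_congr rfl fun i _ => by ring
    _ = _ := by
        simp only [hN', ite_mul, zero_mul, Finset.sum_ite_eq, Finset.mem_univ, if_true,
          Finset.mul_sum]

lemma toEuclideanLin_unitVec_zero {N : Matrix (Fin (n + 1)) (Fin (n + 1)) ℝ} {s : ℝ}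
    (hN : ∀ k, N k 0 = if k = 0 then s else 0) :
    Matrix.toEuclideanLin N (unitVec 0 : E n) = s • unitVec 0 := by
  rw [toEuclideanLin_unitVec]
  simp [hN, ite_smul]

/-- The balance of exponents: the amplitude α⁻ᵖ of |u|ᵖ and the dilation α^(p-1) of the first axis
combine to the factor α⁻¹ of the diffusion term. -/
lemma inv_rpow_mul_rpow_sub_one {α : ℝ} (hα : 0 < α) (p : ℝ) :
    (α ^ p)⁻¹ * α ^ (p - 1) = α⁻¹ := by
  rw [Real.rpow_sub_one hα.ne']
  have := (Real.rpow_pos_of_pos hα p).ne'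
  field_simp

lemma burgersOp_transform_eq_of_condition {ν p α c : ℝ} (hp : 1 < p) (hα : 0 < α)
    {M : Matrix (Fin (n + 1)) (Fin (n + 1)) ℝ} (b : E n)
    (h1 : M⁻¹ * M⁻¹.transpose = c • (1 : Matrix (Fin (n + 1)) (Fin (n + 1)) ℝ))
    (h2 : ∀ k, M⁻¹ k 0 = if k = 0 then c * α ^ (p - 1) else 0)
    {v : E n → ℝ} (hv : ContDiff ℝ 2 v) (x : E n) :
    burgersOp ν p (transform α M b v) x = c * (α⁻¹ * burgersOp ν p v (backward M b x)) := by
  set y := backward M b x with hy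
  have hs : ∀ i, fderiv ℝ (fun y => fderiv ℝ v y (Matrix.toEuclideanLin M⁻¹ (unitVec i)))
      y (Matrix.toEuclideanLin M⁻¹ (unitVec i)) =
      ∑ k, M⁻¹ k i * ∑ l, M⁻¹ l i *
        fderiv ℝ (fun y => fderiv ℝ v y (unitVec k)) y (unitVec l) := by
    intro i
    have hd : ∀ k, DifferentiableAt ℝ (fun y => fderiv ℝ v y (unitVec k)) y := fun k =>
      (contDiff_fderiv_apply_const hv _).differentiable one_ne_zero y
    have hsum : (fun z => fderiv ℝ v z (Matrix.toEuclideanLin M⁻¹ (unitVec i))) =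
        fun z => ∑ k, M⁻¹ k i * fderiv ℝ v z (unitVec k) := by
      ext z
      simp only [toEuclideanLin_unitVec, map_sum, map_smul, smul_eq_mul]
    rw [hsum, (HasFDerivAt.fun_sum fun k _ => (hd k).hasFDerivAt.const_mul (M⁻¹ k i)).fderiv,
      _root_.sum_apply]
    refine Finset.sum_congr rfl fun k _ => ?_
    rw [_root_.smul_apply, smul_eq_mul, toEuclideanLin_unitVec]
    simp only [map_sum, map_smul, smul_eq_mul]
  rw [burgersOp_transform hp hα M b hv, ← hy, toEuclideanLin_unitVec_zero h2]
  simp only [hs]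
  rw [sum_sum_mul_eq_of_mul_transpose h1, burgersOp, laplacian_eq_sum hv, map_smul, smul_eq_mul]
  have hpow := inv_rpow_mul_rpow_sub_one hα p
  linear_combination (-(1 / p * c * fderiv ℝ (fun y => |v y| ^ p) y (unitVec 0))) * hpow

/-- If the transformation rule holds at `b` for all compactly supported `v`, it holds at `b` for
all `v` of class `C²`. -/
lemma burgersOp_transform_eq_of_hasCompactSupport {ν p α c : ℝ}
    {M : Matrix (Fin (n + 1)) (Fin (n + 1)) ℝ} {b : E n}
    (H : ∀ v : E n → ℝ, ContDiff ℝ 2 v → HasCompactSupport v → ∀ x,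
      burgersOp ν p (transform α M b v) x = c * (α⁻¹ * burgersOp ν p v (backward M b x)))
    {q : E n → ℝ} (hq : ContDiff ℝ 2 q) :
    burgersOp ν p (transform α M b q) b = c * (α⁻¹ * burgersOp ν p q 0) := by
  -- The cutoff equals 1 near 0 = M⁻¹(b - b), so neither side changes at b.
  let χ : ContDiffBump (0 : E n) := ⟨1, 2, one_pos, one_lt_two⟩
  have hb : backward M b b = 0 := by simp [backward]
  have h1 : (fun y => χ y * q y) =ᶠ[nhds 0] q := by
    filter_upwards [χ.eventuallyEq_one] with y hy
    simp [hy]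
  have h2 : transform α M b (fun y => χ y * q y) =ᶠ[nhds b] transform α M b q := by
    have ht : Filter.Tendsto (backward M b) (nhds b) (nhds 0) := by
      have := (contDiff_backward M b (k := 0)).continuous.tendsto b
      rwa [hb] at this
    filter_upwards [ht.eventually h1] with x hx
    simp only [transform, hx]
  have h3 := H (fun y => χ y * q y) (χ.contDiff.mul hq) χ.hasCompactSupport.mul_right b
  rwa [hb, burgersOp_congr_nhds h1, burgersOp_congr_nhds h2] at h3

lemma fderiv_abs_rpow_apply {p : ℝ} (hp : 1 < p) {q : E n → ℝ} {y : E n}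
    (hq : DifferentiableAt ℝ q y) (w : E n) :
    fderiv ℝ (fun z => |q z| ^ p) y w = p * |q y| ^ (p - 2) * q y * fderiv ℝ q y w := by
  have h : fderiv ℝ (fun z => |q z| ^ p) y = _ :=
    ((hasDerivAt_abs_rpow (q y) hp).comp_hasFDerivAt y hq.hasFDerivAt).fderiv
  rw [h, _root_.smul_apply, smul_eq_mul]

lemma hasFDerivAt_coord (k : Fin (n + 1)) (y : E n) :
    HasFDerivAt (fun z : E n => z k) (EuclideanSpace.proj k : E n →L[ℝ] ℝ) y :=
  (EuclideanSpace.proj k : E n →L[ℝ] ℝ).hasFDerivAt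

lemma fderiv_coord_mul_coord (k l : Fin (n + 1)) (y w : E n) :
    fderiv ℝ (fun z : E n => z k * z l) y w = y k * w l + y l * w k := by
  rw [((hasFDerivAt_coord k y).fun_mul (hasFDerivAt_coord l y)).fderiv]; rfl

lemma fderiv_fderiv_coord_mul_coord (k l : Fin (n + 1)) (y w : E n) :
    fderiv ℝ (fun z => fderiv ℝ (fun z : E n => z k * z l) z w) y w = 2 * (w k * w l) := by
  simp only [fderiv_coord_mul_coord]
  rw [(((hasFDerivAt_coord k y).mul_const (w l)).fun_add
    ((hasFDerivAt_coord l y).mul_const (w k))).fderiv]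
  change w l * w k + w k * w l = _
  ring

lemma contDiff_coord (k : Fin (n + 1)) {m : WithTop ℕ∞} : ContDiff ℝ m fun z : E n => z k :=
  (EuclideanSpace.proj k : E n →L[ℝ] ℝ).contDiff

/-- At 0 the function zₖzₗ vanishes, which kills the convection term and leaves 2ν/α times the (k,
l) entries. The affine function 1 + zₖ has no second derivatives and equals 1 at 0, which leaves
only the entry (k, 0) of M⁻¹. -/
lemma condition_of_burgersOp_transform_eq {ν p α c : ℝ} (hν : 0 < ν) (hp : 1 < p) (hα : 0 < α)
    {M : Matrix (Fin (n + 1)) (Fin (n + 1)) ℝ} {b : E n}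
    (H : ∀ v : E n → ℝ, ContDiff ℝ 2 v → HasCompactSupport v → ∀ x,
      burgersOp ν p (transform α M b v) x = c * (α⁻¹ * burgersOp ν p v (backward M b x))) :
    M⁻¹ * M⁻¹.transpose = c • (1 : Matrix (Fin (n + 1)) (Fin (n + 1)) ℝ) ∧
      ∀ k, M⁻¹ k 0 = if k = 0 then c * α ^ (p - 1) else 0 := by
  have hb : backward M b b = 0 := by simp [backward]
  have hcol : ∀ k i, (Matrix.toEuclideanLin M⁻¹ (unitVec i : E n)) k = M⁻¹ k i := by
    intro k i
    simp [unitVec, Matrix.toLpLin_apply]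
  have hunit : ∀ k i, (unitVec i : E n) k = if k = i then 1 else 0 := by
    intro k i
    simp [unitVec]
  constructor
  · ext k l
    have hq : ContDiff ℝ 2 fun z : E n => z k * z l := (contDiff_coord k).mul (contDiff_coord l)
    have h := burgersOp_transform_eq_of_hasCompactSupport H hq
    rw [burgersOp_transform hp hα M b hq, hb, burgersOp, laplacian_eq_sum hq] at h
    simp only [fderiv_fderiv_coord_mul_coord,
      fderiv_abs_rpow_apply hp (hq.differentiable two_ne_zero 0), hcol, hunit,
      ← Finset.mul_sum] at h
    simp only [PiLp.zero_apply, mul_zero, zero_mul, sub_zero, mul_ite, mul_one, Finset.sum_ite_eq,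
      Finset.mem_univ, if_true] at h
    rw [Matrix.mul_apply, Matrix.smul_apply, Matrix.one_apply, smul_eq_mul]
    simp only [Matrix.transpose_apply]
    have h' : (2 * ν * α⁻¹) * (∑ i, M⁻¹ k i * M⁻¹ l i) =
        (2 * ν * α⁻¹) * (c * if k = l then 1 else 0) := by
      split_ifs at h ⊢ <;> linear_combination h
    exact mul_left_cancel₀ (by positivity) h'
  · intro k
    have hq : ContDiff ℝ 2 fun z : E n => 1 + z k := contDiff_const.add (contDiff_coord k)
    have hd : ∀ y w : E n, fderiv ℝ (fun z : E n => 1 + z k) y w = w k := by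
      intro y w
      rw [((hasFDerivAt_coord k y).const_add 1).fderiv]; rfl
    have h := burgersOp_transform_eq_of_hasCompactSupport H hq
    rw [burgersOp_transform hp hα M b hq, hb, burgersOp, laplacian_eq_sum hq] at h
    simp only [fderiv_abs_rpow_apply hp (hq.differentiable two_ne_zero 0), hd, hcol, hunit] at h
    simp only [fderiv_fun_const, Pi.zero_apply, _root_.zero_apply, Finset.sum_const_zero, mul_zero,
      PiLp.zero_apply, add_zero, abs_one, Real.one_rpow, mul_one, zero_sub] at h
    have hp0 : p ≠ 0 := by positivity
    have hpow := inv_rpow_mul_rpow_sub_one hα p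
    have hαp : (α ^ p)⁻¹ ≠ 0 := (inv_pos.2 (Real.rpow_pos_of_pos hα p)).ne'
    refine mul_left_cancel₀ hαp ?_
    have h' : (α ^ p)⁻¹ * M⁻¹ k 0 = c * α⁻¹ * if k = 0 then 1 else 0 := by
      have e1 : 1 / p * ((α ^ p)⁻¹ * (p * M⁻¹ k 0)) = (α ^ p)⁻¹ * M⁻¹ k 0 := by
        field_simp
      have e2 : 1 / p * (p * if k = 0 then (1 : ℝ) else 0) = if k = 0 then 1 else 0 := by
        field_simp
      rw [e1, e2] at h
      linear_combination -h
    rw [h']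
    split_ifs
    · linear_combination (-c) * hpow
    · simp

end Classical

/-! ### Comparison of the weak and classical operators, and the weak transformation rule -/

lemma memLp_of_continuous_hasCompactSupport {u : E n → ℝ} (hu : Continuous u)
    (hc : HasCompactSupport u) (q : ℝ≥0∞) : MemLp u q :=
  hu.memLp_of_hasCompactSupport hc

section

variable {u : E n → ℝ}

lemma hasWeakPartial_of_contDiff_two (hu : ContDiff ℝ 2 u) (i : Fin (n + 1)) :
    HasWeakPartial i u fun x => fderiv ℝ u x (unitVec i) :=
  hasWeakDir_of_contDiff (hu.of_le one_le_two) _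

lemma hasWeakPartial_fderiv_of_contDiff_two (hu : ContDiff ℝ 2 u) (i j : Fin (n + 1)) :
    HasWeakPartial j (fun x => fderiv ℝ u x (unitVec i))
      fun x => fderiv ℝ (fun y => fderiv ℝ u y (unitVec i)) x (unitVec j) :=
  hasWeakDir_of_contDiff (contDiff_fderiv_apply_const hu _) _

lemma memH2Linf_of_contDiff_hasCompactSupport (hu : ContDiff ℝ 2 u) (hc : HasCompactSupport u) :
    MemH2Linf u := by
  refine ⟨⟨memLp_of_continuous_hasCompactSupport hu.continuous hc _, _, _, fun i => ⟨?_,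
    hasWeakPartial_of_contDiff_two hu i⟩, fun i j => ⟨?_,
    hasWeakPartial_fderiv_of_contDiff_two hu i j⟩⟩,
    memLp_of_continuous_hasCompactSupport hu.continuous hc _⟩
  · exact memLp_of_continuous_hasCompactSupport (contDiff_fderiv_apply_const hu _).continuous
      (hc.fderiv_apply (𝕜 := ℝ) _) _
  · exact memLp_of_continuous_hasCompactSupport
      (continuous_fderiv_apply_const (contDiff_fderiv_apply_const hu _) _)
      ((hc.fderiv_apply (𝕜 := ℝ) _).fderiv_apply (𝕜 := ℝ) _) _

/-- For functions of class `C²`, the weak operator `F` is the classical one. -/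
lemma IsBurgersL2.ae_eq_burgersOp {ν p : ℝ} (hp : 1 < p) (hu : ContDiff ℝ 2 u)
    {f : Lp ℝ 2 (volume : Measure (E n))} (hf : IsBurgersL2 ν p u f) :
    f =ᵐ[volume] burgersOp ν p u := by
  have hw : HasWeakPartial 0 (fun x => |u x| ^ p)
      fun x => fderiv ℝ (fun y => |u y| ^ p) x (unitVec 0) :=
    hasWeakDir_of_contDiff (contDiff_comp_abs_rpow hp (hu.of_le one_le_two)) _
  filter_upwards [hf.ae_eq (hasWeakPartial_of_contDiff_two hu)
    (fun i => hasWeakPartial_fderiv_of_contDiff_two hu i i) hw] with x hx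
  rw [hx, burgersOp, laplacian_eq_sum hu]

end

lemma hasCompactSupport_transform {α : ℝ} {M : Matrix (Fin (n + 1)) (Fin (n + 1)) ℝ}
    (hM : IsUnit M) (b : E n) {v : E n → ℝ} (hc : HasCompactSupport v) :
    HasCompactSupport (transform α M b v) :=
  (hc.comp_homeomorph (backwardHomeo hM b)).mul_left

/-- For compactly supported C² functions both sides are continuous representatives of the L²
identity, and continuous functions that agree almost everywhere agree everywhere. -/
lemma burgersOp_transform_eq_of_isBurgersL2 {ν p α c : ℝ} (hp : 1 < p)
    {M : Matrix (Fin (n + 1)) (Fin (n + 1)) ℝ} (hM : IsUnit M) {b : E n}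
    (H : ∀ v : E n → ℝ, MemH2Linf v → ∀ f g : Lp ℝ 2 (volume : Measure (E n)),
      IsBurgersL2 ν p (transform α M b v) f → IsBurgersL2 ν p v g →
      f =ᵐ[volume] fun x => c * (α⁻¹ * g (backward M b x)))
    {v : E n → ℝ} (hv : ContDiff ℝ 2 v) (hc : HasCompactSupport v) (x : E n) :
    burgersOp ν p (transform α M b v) x = c * (α⁻¹ * burgersOp ν p v (backward M b x)) := by
  have hu := contDiff_transform M b α hv
  obtain ⟨f, hf⟩ := exists_isBurgersL2 ν hp
    (memH2Linf_of_contDiff_hasCompactSupport hu (hasCompactSupport_transform hM b hc))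
  have hvm := memH2Linf_of_contDiff_hasCompactSupport hv hc
  obtain ⟨g, hg⟩ := exists_isBurgersL2 ν hp hvm
  have hae : burgersOp ν p (transform α M b v) =ᵐ[volume]
      fun x => c * (α⁻¹ * burgersOp ν p v (backward M b x)) := by
    filter_upwards [H v hvm f g hf hg, hf.ae_eq_burgersOp hp hu,
      (quasiMeasurePreserving_backward hM b).ae (hg.ae_eq_burgersOp hp hv)] with y h1 h2 h3
    rw [← h2, h1, h3]
  refine congrFun ((Continuous.ae_eq_iff_eq volume (continuous_burgersOp ν hp hu) ?_).1 hae) x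
  exact (((continuous_burgersOp ν hp hv).comp
    (contDiff_backward M b (k := 0)).continuous).const_mul _).const_mul _

lemma ae_eq_of_isBurgersL2_of_condition {ν p α c : ℝ} (hα : 0 < α)
    {M : Matrix (Fin (n + 1)) (Fin (n + 1)) ℝ} (hM : IsUnit M) (b : E n)
    (h1 : M⁻¹ * M⁻¹.transpose = c • (1 : Matrix (Fin (n + 1)) (Fin (n + 1)) ℝ))
    (h2 : ∀ k, M⁻¹ k 0 = if k = 0 then c * α ^ (p - 1) else 0)
    {v : E n → ℝ} (hv : MemH2Linf v) {f F : Lp ℝ 2 (volume : Measure (E n))}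
    (hf : IsBurgersL2 ν p (transform α M b v) f) (hF : IsBurgersL2 ν p v F) :
    f =ᵐ[volume] fun x => c * (α⁻¹ * F (backward M b x)) := by
  obtain ⟨⟨-, g, h, hg, hh⟩, -⟩ := hv
  -- Only the weak derivative of |v|ᵖ is taken from `hF`; the mixed second derivatives needed for
  -- the change of variables come from v ∈ H².
  obtain ⟨-, -, w, -, -, hw, -⟩ := id hF
  have hFae := hF.ae_eq (fun i => (hg i).2) (fun i => (hh i i).2) hw
  have hwt : HasWeakPartial 0 (fun x => |transform α M b v x| ^ p)
      fun x => (α ^ p)⁻¹ * (c * α ^ (p - 1) * w (backward M b x)) := by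
    rw [abs_transform_rpow hα]
    refine HasWeakDir.const_mul (HasWeakDir.comp_backward hM b
      (v := fun y => |v y| ^ p) (g := fun y => c * α ^ (p - 1) * w y) ?_) _
    rw [toEuclideanLin_unitVec_zero h2]
    exact HasWeakDir.smul_dir hw _
  have hfae := hf.ae_eq (hasWeakPartial_transform hM b α fun i => (hg i).2)
    (fun i => hasWeakPartial_transform_second hM b α (fun k l => (hh k l).2) i i) hwt
  filter_upwards [hfae, (quasiMeasurePreserving_backward hM b).ae hFae] with x h3 h4
  rw [h3, h4, ← Finset.mul_sum,
    sum_sum_mul_eq_of_mul_transpose h1 fun k l => h k l (backward M b x)]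
  linear_combination (-(1 / p * c * w (backward M b x))) * inv_rpow_mul_rpow_sub_one hα p

end Burgers

end

theorem proposition2p2 (n : ℕ) (ν p : ℝ) (hν : 0 < ν) (hp : 1 < p)
    (α : ℝ) (hα : 0 < α) (b : Burgers.E n)
    (M : Matrix (Fin (n + 1)) (Fin (n + 1)) ℝ) (hM : IsUnit M) (c : ℝ) :
    -- the case of `C²`: `F` is well defined, `u ∈ C²` iff `v ∈ C²`, and the equivalence
    ((∀ u : Burgers.E n → ℝ, ContDiff ℝ 2 u →
        Differentiable ℝ (fun x => |u x| ^ p) ∧ Continuous (Burgers.burgersOp ν p u)) ∧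
      (∀ v : Burgers.E n → ℝ,
        ContDiff ℝ 2 (Burgers.transform α M b v) ↔ ContDiff ℝ 2 v) ∧
      ((∀ v : Burgers.E n → ℝ, ContDiff ℝ 2 v →
          ∀ x, Burgers.burgersOp ν p (Burgers.transform α M b v) x =
            c * (α⁻¹ * Burgers.burgersOp ν p v (Burgers.backward M b x))) ↔
        (∃ Q ∈ Matrix.orthogonalGroup (Fin n) ℝ, M = α ^ (p - 1) • Burgers.blockOne Q) ∧
          c = α ^ (2 - 2 * p))) ∧
    -- the case of `H² ∩ L^∞`: the same three claims
    ((∀ u : Burgers.E n → ℝ, Burgers.MemH2Linf u →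
        ∃! f : Lp ℝ 2 (volume : Measure (Burgers.E n)), Burgers.IsBurgersL2 ν p u f) ∧
      (∀ v : Burgers.E n → ℝ,
        Burgers.MemH2Linf (Burgers.transform α M b v) ↔ Burgers.MemH2Linf v) ∧
      ((∀ v : Burgers.E n → ℝ, Burgers.MemH2Linf v →
          ∀ f g : Lp ℝ 2 (volume : Measure (Burgers.E n)),
            Burgers.IsBurgersL2 ν p (Burgers.transform α M b v) f →
            Burgers.IsBurgersL2 ν p v g →
            f =ᵐ[volume] fun x => c * (α⁻¹ * g (Burgers.backward M b x))) ↔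
        (∃ Q ∈ Matrix.orthogonalGroup (Fin n) ℝ, M = α ^ (p - 1) • Burgers.blockOne Q) ∧
          c = α ^ (2 - 2 * p))) := by 
  have hr : 0 < α ^ (p - 1) := Real.rpow_pos_of_pos hα _
  have hc : α ^ (2 - 2 * p) = ((α ^ (p - 1)) ^ 2)⁻¹ := by
    rw [← Real.rpow_natCast, ← Real.rpow_mul hα.le, ← Real.rpow_neg hα.le]
    congr 1
    push_cast
    ring
  -- With r = α^(p-1), the condition in both equivalences becomes the one on the entries of M⁻¹.
  rw [hc, ← Burgers.inv_mul_transpose_iff hM hr]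
  refine ⟨⟨fun u hu => ⟨?_, Burgers.continuous_burgersOp ν hp hu⟩,
    Burgers.contDiff_transform_iff hM b hα.ne', fun H => ?_, fun H v hv x => ?_⟩,
    fun u hu => Burgers.existsUnique_isBurgersL2 ν hp hu,
    Burgers.memH2Linf_transform_iff hM b hα.ne', fun H => ?_, fun H v hv f g hf hg => ?_⟩
  · exact (Burgers.contDiff_comp_abs_rpow hp (hu.of_le one_le_two)).differentiable one_ne_zero
  · exact Burgers.condition_of_burgersOp_transform_eq hν hp hα fun v hv _ => H v hv
  · exact Burgers.burgersOp_transform_eq_of_condition hp hα b H.1 H.2 hv x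
  · exact Burgers.condition_of_burgersOp_transform_eq hν hp hα fun v hv hvc =>
      Burgers.burgersOp_transform_eq_of_isBurgersL2 hp hM H hv hvc
  · exact Burgers.ae_eq_of_isBurgersL2_of_condition hα hM b H.1 H.2 hv hf hg
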